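/- Let $\mathbb T^1=\mathbb R/\mathbb Z$ and $\mathbb T^2=\mathbb T^1\times\mathbb T^1$, both with normalized Lebesgue measure. For $L>0$ let $F_L:\mathbb T^2\to\mathbb T^2$ be the Chirikov standard map $$F_L(x,y)=\bigl(x+y+L\sin(2\pi x),\; y+L\sin(2\pi x)\bigr)\pmod 1 .$$ For a $C^1$ function $g:\mathbb T^1\to\mathbb R$ put $\|g\|_{C^1}=\max\{\sup|g|,\ \sup|g'|\}$, and regard $g$ also as the function $(x,y)\mapsto g(x)$ on $\mathbb T^2$. Then there are constants $C>0$ and $L_0>0$ such that for all $L\ge L_0$, all $C^1$ functions $\varphi,\psi:\mathbb T^1\to\mathbb R$ and all integers $n\ge 1$, $$\left|\int_{\mathbb T^2}\psi\cdot(\varphi\circ F_L^n)\,d\mathrm{Leb}-\int_{\mathbb T^1}\varphi\,dx\int_{\mathbb T^1}\psi\,dx\right|\le C\,\|\varphi\|_{C^1}\|\psi\|_{C^1}\Bigl((n-1)L^{-3/4}+L^{-1/2}\Bigr).$$ -/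

import Mathlib

open MeasureTheory

/-- The function `x ↦ sin (2 π x)` on the circle `𝕋¹ = ℝ / ℤ`. -/
noncomputable def circleSin : UnitAddCircle → ℝ :=
  Function.Periodic.lift (f := fun t : ℝ => Real.sin (2 * Real.pi * t)) (c := 1) (fun t => by
    have h : 2 * Real.pi * (t + 1) = 2 * Real.pi * t + 2 * Real.pi := by ring
    simp only [h, Real.sin_add_two_pi])

/-- The standard map `F_L (x, y) = (x + y + L sin (2 π x), y + L sin (2 π x))` on the torus
`𝕋² = 𝕋¹ × 𝕋¹`; both coordinates are taken modulo `1`. -/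
noncomputable def standardMap (L : ℝ) (p : UnitAddCircle × UnitAddCircle) :
    UnitAddCircle × UnitAddCircle :=
  (p.1 + p.2 + ((L * circleSin p.1 : ℝ) : UnitAddCircle),
    p.2 + ((L * circleSin p.1 : ℝ) : UnitAddCircle))

/-- The `1`-periodic function on the real line that corresponds to a function on the circle. -/
def periodicLift (g : UnitAddCircle → ℝ) : ℝ → ℝ := fun t => g (t : UnitAddCircle)

/-- A function on the circle is `C¹` if the corresponding periodic function on `ℝ` is. -/
def IsC1 (g : UnitAddCircle → ℝ) : Prop := ContDiff ℝ 1 (periodicLift g)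

/-- The norm `‖g‖_{C¹} = max (sup |g|) (sup |g'|)` of a `C¹` function on the circle (both suprema
are of bounded sets, since `g` and `g'` are continuous and the circle is compact). -/
noncomputable def c1Norm (g : UnitAddCircle → ℝ) : ℝ :=
  max (⨆ t : ℝ, |periodicLift g t|) (⨆ t : ℝ, |deriv (periodicLift g) t|)

/-! Fix the initial position `a` and let the momentum vary. The position `b` at time 1 is then
uniform on the circle, and later positions are functions of `b` obeying x(k+1) = `kick L` (x(k)) -
x(k-1). Since ψ depends on the initial position only, Fubini reduces the theorem to equidistribution
of b ↦ x(n)(b), uniformly in `a`.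

If x' were large everywhere, writing 1 = (1/x') x' and integrating by parts would bound the
discrepancy by the variation of 1/x'. Critical points spoil this, so 1/x' is replaced by a C¹ weight
`p` with 0 ≤ p x' ≤ 1 that vanishes near them. The discrepancy is then controlled by the variation
of `p` and the lost mass 1 - ∫ p x' (`abs_integral_comp_sub_le`).

With σ = z'/x' the ratio of successive derivatives, one step multiplies x' by `kickDeriv L` (x) - σ.
The new weight divides by this factor, smoothly cut off where it is at most K in size. Both the new
variation and the lost mass are integrals of `kickKernel` along the curve; equidistribution of the
current curve, applied to this kernel, bounds them by O((1 + V)/K) and O((1 + V) K/L), where V is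
the old variation (`variation_next_le`, `integral_mass_sub_next_le`). So V stays at most 1 for K ≥
80000. All steps but the last use K = L^(1/4), losing O(L^(-3/4)) of mass each; the last uses K =
L^(1/2), which makes variation and loss both O(L^(-1/2)). -/

/-! ### C¹ cutoffs of the reciprocal function -/

/-- The square of the positive part. -/
noncomputable def posSq (u : ℝ) : ℝ := max u 0 ^ 2

open Filter Topology in
theorem hasDerivAt_posSq (u : ℝ) : HasDerivAt posSq (2 * max u 0) u := by
  rcases lt_trichotomy u 0 with hu | hu | hu
  · have h : posSq =ᶠ[𝓝 u] fun _ => (0 : ℝ) := by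
      filter_upwards [eventually_lt_nhds hu] with v hv
      simp [posSq, max_eq_right hv.le]
    rw [max_eq_right hu.le, mul_zero]
    exact (hasDerivAt_const u (0 : ℝ)).congr_of_eventuallyEq h
  · subst hu
    rw [hasDerivAt_iff_tendsto_slope]
    have h : Tendsto (fun v : ℝ => max v 0) (𝓝[≠] 0) (𝓝 (2 * max (0 : ℝ) 0)) := by
      have : Continuous fun v : ℝ => max v 0 := by fun_prop
      simpa using (this.tendsto 0).mono_left nhdsWithin_le_nhds
    refine h.congr' ?_
    filter_upwards [self_mem_nhdsWithin] with v hv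
    rw [slope_def_field]
    rcases le_total v 0 with h0 | h0
    · simp [posSq, max_eq_right h0]
    · simp only [posSq, max_eq_left h0, max_self]
      have : v ≠ 0 := hv
      field_simp
      ring
  · have h : posSq =ᶠ[𝓝 u] fun v => v ^ 2 := by
      filter_upwards [eventually_gt_nhds hu] with v hv
      simp [posSq, max_eq_left hv.le]
    rw [max_eq_left hu.le]
    have := (hasDerivAt_pow 2 u).congr_of_eventuallyEq h
    simpa using this

theorem contDiff_posSq : ContDiff ℝ 1 posSq := by
  rw [contDiff_one_iff_deriv]
  refine ⟨fun u => (hasDerivAt_posSq u).differentiableAt, ?_⟩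
  have : deriv posSq = fun u => 2 * max u 0 := funext fun u => (hasDerivAt_posSq u).deriv
  rw [this]
  fun_prop

theorem posSq_nonneg (u : ℝ) : 0 ≤ posSq u := sq_nonneg _

theorem posSq_of_nonneg {u : ℝ} (hu : 0 ≤ u) : posSq u = u ^ 2 := by
  simp [posSq, max_eq_left hu]

theorem posSq_of_nonpos {u : ℝ} (hu : u ≤ 0) : posSq u = 0 := by
  simp [posSq, max_eq_right hu]

/-- A denominator that equals `t ^ 2` for `1 ≤ |t|` and stays away from zero. -/
noncomputable def cutDenom (t : ℝ) : ℝ := t ^ 2 + posSq (1 - t ^ 2) / 2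

/-- With v = t² ≤ 1 the denominator is (1 + v²)/2; for v ≥ 1 it is v. -/
theorem le_cutDenom (t : ℝ) : (1 + t ^ 2) / 4 ≤ cutDenom t := by
  unfold cutDenom
  rcases le_total (t ^ 2) 1 with h | h
  · rw [posSq_of_nonneg (by linarith)]
    nlinarith [sq_nonneg (t ^ 2 - 1 / 4)]
  · rw [posSq_of_nonpos (by linarith)]
    linarith

theorem cutDenom_pos (t : ℝ) : 0 < cutDenom t :=
  lt_of_lt_of_le (by positivity) (le_cutDenom t)

/-- A `C¹` function that equals `1 / t` for `1 ≤ |t|`. -/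
noncomputable def cutInv (t : ℝ) : ℝ := t / cutDenom t

theorem contDiff_cutDenom : ContDiff ℝ 1 cutDenom := by
  unfold cutDenom
  have := contDiff_posSq
  fun_prop

theorem contDiff_cutInv : ContDiff ℝ 1 cutInv :=
  contDiff_id.div contDiff_cutDenom fun t => (cutDenom_pos t).ne'

theorem cutInv_mul_self {t : ℝ} (ht : 1 ≤ t ^ 2) : cutInv t * t = 1 := by
  have : t ≠ 0 := by rintro rfl; norm_num at ht
  unfold cutInv cutDenom
  rw [posSq_of_nonpos (by linarith)]
  field_simp
  ring

theorem abs_cutInv_le (t : ℝ) : |cutInv t| ≤ 2 := by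
  rw [cutInv, abs_div, abs_of_pos (cutDenom_pos t), div_le_iff₀ (cutDenom_pos t)]
  have h := le_cutDenom t
  rw [← sq_abs] at h
  nlinarith [sq_nonneg (|t| - 1)]

/-- The decay is that of the derivative of 1/t; after rescaling by K it turns into the denominator
of `kickKernel`. -/
theorem abs_deriv_cutInv_le (t : ℝ) : |deriv cutInv t| ≤ 50 / (1 + t ^ 2) := by
  have hm := cutDenom_pos t
  have h1 : HasDerivAt cutDenom (2 * t - 2 * t * max (1 - t ^ 2) 0) t := by
    have h2 : HasDerivAt (fun t : ℝ => 1 - t ^ 2) (-(2 * t)) t := by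
      simpa using (hasDerivAt_pow 2 t).const_sub 1
    have h3 := ((hasDerivAt_posSq (1 - t ^ 2)).comp t h2).div_const 2
    have h4 := (hasDerivAt_pow 2 t).add h3
    refine h4.congr_deriv ?_
    simp only [Nat.cast_ofNat]
    ring
  have h2 := (hasDerivAt_id t).div h1 hm.ne'
  have h3 : deriv cutInv t = 1 / cutDenom t
      - 2 * t ^ 2 * (1 - max (1 - t ^ 2) 0) / cutDenom t ^ 2 := by
    have h4 : deriv cutInv t = _ := h2.deriv
    rw [h4]
    simp only [id]
    field_simp
  have h4 : 0 ≤ 1 - max (1 - t ^ 2) 0 ∧ 1 - max (1 - t ^ 2) 0 ≤ 1 := by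
    constructor
    · have : max (1 - t ^ 2) 0 ≤ 1 := max_le (by nlinarith [sq_nonneg t]) zero_le_one
      linarith
    · have := le_max_right (1 - t ^ 2) 0
      linarith
  have hle := le_cutDenom t
  have hv := sq_nonneg t
  have hA : 1 / cutDenom t ≤ 4 / (1 + t ^ 2) := by
    rw [div_le_div_iff₀ hm (by positivity)]
    linarith
  have hB : 2 * t ^ 2 * (1 - max (1 - t ^ 2) 0) / cutDenom t ^ 2 ≤ 32 / (1 + t ^ 2) := by
    calc _ ≤ 2 * (1 + t ^ 2) * 1 / ((1 + t ^ 2) / 4) ^ 2 := by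
          gcongr
          · exact h4.1
          · linarith
          · exact h4.2
      _ = 32 / (1 + t ^ 2) := by field_simp; norm_num
  have hA0 : 0 ≤ 1 / cutDenom t := by positivity
  have hB0 : 0 ≤ 2 * t ^ 2 * (1 - max (1 - t ^ 2) 0) / cutDenom t ^ 2 :=
    div_nonneg (mul_nonneg (by positivity) h4.1) (by positivity)
  have hC : 4 / (1 + t ^ 2) + 32 / (1 + t ^ 2) ≤ 50 / (1 + t ^ 2) := by
    rw [← add_div]
    gcongr
    norm_num
  rw [h3, abs_le]
  constructor <;> linarith

/-- A `C¹` function that vanishes for `|t| ≤ 1` and is close to `1 / t` for large `|t|`. -/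
noncomputable def cutQuot (t : ℝ) : ℝ := t * posSq (t ^ 2 - 1) / (1 + t ^ 2 * posSq (t ^ 2 - 1))

theorem cutQuot_denom_pos (t : ℝ) : 0 < 1 + t ^ 2 * posSq (t ^ 2 - 1) := by
  have := posSq_nonneg (t ^ 2 - 1)
  positivity

theorem contDiff_cutQuot : ContDiff ℝ 1 cutQuot := by
  have := contDiff_posSq
  exact ContDiff.div (by fun_prop) (by fun_prop) fun t => (cutQuot_denom_pos t).ne'

theorem cutQuot_of_sq_le {t : ℝ} (ht : t ^ 2 ≤ 1) : cutQuot t = 0 := by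
  simp [cutQuot, posSq_of_nonpos (sub_nonpos.2 ht)]

/-- `cutQuot` vanishes wherever `cutInv` is not the exact reciprocal. This keeps the slope relation
exact after a step, despite the cutoff. -/
theorem cutQuot_mul_cutInv_mul (t : ℝ) : cutInv t * (cutQuot t * t) = cutQuot t := by
  rcases le_total (t ^ 2) 1 with h | h
  · simp [cutQuot_of_sq_le h]
  · rw [mul_left_comm, cutInv_mul_self h, mul_one]

theorem abs_cutQuot_le (t : ℝ) : |cutQuot t| ≤ 1 := by
  rcases le_total (t ^ 2) 1 with h | h
  · simp [cutQuot_of_sq_le h]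
  · have hp := posSq_nonneg (t ^ 2 - 1)
    rw [cutQuot, abs_div, abs_of_pos (cutQuot_denom_pos t), div_le_one (cutQuot_denom_pos t),
      abs_mul, abs_of_nonneg hp]
    have : |t| ≤ t ^ 2 := by
      have : 1 ≤ |t| := by rwa [← one_le_sq_iff_one_le_abs]
      rw [← sq_abs]
      nlinarith
    nlinarith

theorem cutQuot_mul_self (t : ℝ) :
    cutQuot t * t = 1 - 1 / (1 + t ^ 2 * posSq (t ^ 2 - 1)) := by
  have := cutQuot_denom_pos t
  unfold cutQuot
  field_simp
  ring

theorem cutQuot_mul_self_nonneg (t : ℝ) : 0 ≤ cutQuot t * t := by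
  have hp := posSq_nonneg (t ^ 2 - 1)
  rw [cutQuot_mul_self, sub_nonneg, div_le_one (cutQuot_denom_pos t)]
  nlinarith [mul_nonneg (sq_nonneg t) hp]

theorem cutQuot_mul_self_le_one (t : ℝ) : cutQuot t * t ≤ 1 := by
  have := cutQuot_denom_pos t
  rw [cutQuot_mul_self]
  have : 0 ≤ 1 / (1 + t ^ 2 * posSq (t ^ 2 - 1)) := by positivity
  linarith

/-- The left side is the fraction of mass discarded in one step. -/
theorem one_sub_cutQuot_mul_self_le (t : ℝ) : 1 - cutQuot t * t ≤ 3 / (1 + t ^ 2) := by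
  have := cutQuot_denom_pos t
  rw [cutQuot_mul_self, sub_sub_cancel, div_le_div_iff₀ this (by positivity)]
  have hp := posSq_nonneg (t ^ 2 - 1)
  have hv := sq_nonneg t
  rcases le_total (t ^ 2) 2 with h | h
  · nlinarith [mul_nonneg hv hp]
  · have : 1 ≤ posSq (t ^ 2 - 1) := by
      rw [posSq_of_nonneg (by linarith)]
      nlinarith
    nlinarith

theorem abs_deriv_cutQuot_le (t : ℝ) : |deriv cutQuot t| ≤ 50 / (1 + t ^ 2) := by
  have hD := cutQuot_denom_pos t
  set Y := posSq (t ^ 2 - 1) with hY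
  have hp : 0 ≤ Y := posSq_nonneg (t ^ 2 - 1)
  have hY' : HasDerivAt (fun t : ℝ => posSq (t ^ 2 - 1)) (4 * t * max (t ^ 2 - 1) 0) t := by
    have h2 : HasDerivAt (fun t : ℝ => t ^ 2 - 1) (2 * t) t := by
      simpa using (hasDerivAt_pow 2 t).sub_const 1
    refine ((hasDerivAt_posSq (t ^ 2 - 1)).comp t h2).congr_deriv ?_
    ring
  have h1 := ((hasDerivAt_id t).mul hY').div
    (((hasDerivAt_pow 2 t).mul hY').const_add 1) hD.ne'
  have h3 : deriv cutQuot t = (Y + 4 * t ^ 2 * max (t ^ 2 - 1) 0 - t ^ 2 * Y ^ 2)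
      / (1 + t ^ 2 * Y) ^ 2 := by
    have h4 : deriv cutQuot t = _ := h1.deriv
    rw [h4]
    congr 1
    simp [← hY]
    ring
  rw [h3, abs_div, abs_of_pos (by positivity : 0 < (1 + t ^ 2 * Y) ^ 2),
    div_le_div_iff₀ (by positivity) (by positivity)]
  rcases le_total (t ^ 2) 1 with h | h
  · have : Y = 0 := posSq_of_nonpos (by linarith)
    rw [this, max_eq_right (by linarith)]
    simp
  · have hYe : Y = (t ^ 2 - 1) ^ 2 := posSq_of_nonneg (by linarith)
    rw [max_eq_left (by linarith)]
    have hvY : 0 ≤ t ^ 2 * Y := by positivity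
    have hA : Y * (1 + t ^ 2) ≤ 2 * (1 + t ^ 2 * Y) ^ 2 := by nlinarith
    have hB : t ^ 2 * Y ^ 2 * (1 + t ^ 2) ≤ 2 * (1 + t ^ 2 * Y) ^ 2 := by
      have h5 : t ^ 2 * Y ^ 2 * (1 + t ^ 2) ≤ t ^ 2 * Y ^ 2 * (2 * t ^ 2) := by
        gcongr
        linarith
      nlinarith
    -- For t² ≤ 2 the left side is at most 24; for t² ≥ 2 one has t² - 1 ≤ Y and 1 ≤ Y, so it is at
    -- most 8 (t² Y)².
    have hC : 4 * t ^ 2 * (t ^ 2 - 1) * (1 + t ^ 2) ≤ 40 * (1 + t ^ 2 * Y) ^ 2 := by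
      rcases le_total (t ^ 2) 2 with h6 | h6
      · have : 4 * t ^ 2 * (t ^ 2 - 1) * (1 + t ^ 2) ≤ 4 * 2 * 1 * 3 := by
          gcongr <;> linarith
        nlinarith
      · have h7 : t ^ 2 - 1 ≤ Y := by rw [hYe]; nlinarith
        have h8 : 1 ≤ Y := by linarith
        have h9 : 4 * t ^ 2 * (t ^ 2 - 1) * (1 + t ^ 2) ≤ 4 * t ^ 2 * Y * (2 * t ^ 2) := by
          gcongr
          linarith
        have h10 : 4 * t ^ 2 * Y * (2 * t ^ 2) ≤ 4 * t ^ 2 * Y * (2 * t ^ 2) * Y := by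
          exact le_mul_of_one_le_right (by positivity) h8
        nlinarith
    have hN : |Y + 4 * t ^ 2 * (t ^ 2 - 1) - t ^ 2 * Y ^ 2| ≤
        Y + 4 * t ^ 2 * (t ^ 2 - 1) + t ^ 2 * Y ^ 2 := by
      have : 0 ≤ 4 * t ^ 2 * (t ^ 2 - 1) := mul_nonneg (by positivity) (by linarith)
      have : 0 ≤ t ^ 2 * Y ^ 2 := by positivity
      rw [abs_le]
      constructor <;> linarith
    have hv : 0 ≤ 1 + t ^ 2 := by positivity
    have := mul_le_mul_of_nonneg_right hN hv
    have : 0 ≤ (1 + t ^ 2 * Y) ^ 2 := by positivity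
    linarith

/-! ### The kick and its kernel near critical points -/

/-- The function `t ↦ 2 t + L sin (2 π t)`, which generates the second order recursion
`x (k + 1) = kick L (x k) - x (k - 1)` of the first coordinate. -/
noncomputable def kick (L t : ℝ) : ℝ := 2 * t + L * Real.sin (2 * Real.pi * t)

/-- The derivative of `kick`. -/
noncomputable def kickDeriv (L t : ℝ) : ℝ := 2 + 2 * Real.pi * L * Real.cos (2 * Real.pi * t)

theorem hasDerivAt_two_pi_mul (t : ℝ) :
    HasDerivAt (fun t : ℝ => 2 * Real.pi * t) (2 * Real.pi) t := by
  simpa using (hasDerivAt_id t).const_mul (2 * Real.pi)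

theorem hasDerivAt_kick (L t : ℝ) : HasDerivAt (kick L) (kickDeriv L t) t := by
  have h := ((hasDerivAt_id t).const_mul 2).add ((hasDerivAt_two_pi_mul t).sin.const_mul L)
  refine h.congr_deriv ?_
  unfold kickDeriv
  ring

theorem hasDerivAt_kickDeriv (L t : ℝ) :
    HasDerivAt (kickDeriv L) (-(4 * Real.pi ^ 2 * L * Real.sin (2 * Real.pi * t))) t := by
  have h := ((hasDerivAt_two_pi_mul t).cos.const_mul (2 * Real.pi * L)).const_add 2
  refine h.congr_deriv ?_
  ring

theorem contDiff_kick (L : ℝ) : ContDiff ℝ 1 (kick L) := by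
  unfold kick
  fun_prop

theorem contDiff_kickDeriv (L : ℝ) : ContDiff ℝ 1 (kickDeriv L) := by
  unfold kickDeriv
  fun_prop

theorem cos_two_pi_mul_add_int (t : ℝ) (m : ℤ) :
    Real.cos (2 * Real.pi * (t + m)) = Real.cos (2 * Real.pi * t) := by
  rw [← Real.cos_add_int_mul_two_pi (2 * Real.pi * t) m]
  ring_nf

theorem sin_two_pi_mul_add_int (t : ℝ) (m : ℤ) :
    Real.sin (2 * Real.pi * (t + m)) = Real.sin (2 * Real.pi * t) := by
  rw [← Real.sin_add_int_mul_two_pi (2 * Real.pi * t) m]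
  ring_nf

theorem kickDeriv_add_int (L t : ℝ) (m : ℤ) : kickDeriv L (t + m) = kickDeriv L t := by
  unfold kickDeriv
  rw [cos_two_pi_mul_add_int]

theorem kick_add_int (L t : ℝ) (m : ℤ) : kick L (t + m) = kick L t + 2 * m := by
  unfold kick
  rw [sin_two_pi_mul_add_int]
  ring

theorem abs_deriv_kickDeriv_le {L : ℝ} (hL : 0 ≤ L) (t : ℝ) : |deriv (kickDeriv L) t| ≤ 40 * L := by
  rw [(hasDerivAt_kickDeriv L t).deriv, abs_neg, abs_mul, abs_of_nonneg (by positivity)]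
  have h1 := Real.abs_sin_le_one (2 * Real.pi * t)
  have h2 : Real.pi ^ 2 ≤ 10 := by nlinarith [Real.pi_lt_d2, Real.pi_pos]
  calc _ ≤ 4 * 10 * L * 1 := by gcongr
    _ = 40 * L := by ring

/-- The kernel that controls one step of the map. -/
noncomputable def kickKernel (L K t : ℝ) : ℝ := L / (K ^ 2 + kickDeriv L t ^ 2)

theorem kickKernel_denom_pos {K : ℝ} (hK : 0 < K) (s : ℝ) : 0 < K ^ 2 + s ^ 2 := by
  positivity

theorem continuous_kickKernel (L : ℝ) {K : ℝ} (hK : 0 < K) : Continuous (kickKernel L K) := by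
  have := (contDiff_kickDeriv L).continuous
  exact continuous_const.div (by fun_prop) fun t => (kickKernel_denom_pos hK _).ne'

theorem kickKernel_nonneg {L : ℝ} (hL : 0 ≤ L) (K t : ℝ) : 0 ≤ kickKernel L K t := by
  unfold kickKernel
  positivity

theorem periodic_kickKernel (L K : ℝ) : Function.Periodic (kickKernel L K) 1 := fun t => by
  have := kickDeriv_add_int L t 1
  unfold kickKernel
  simp_all

/-- Split 1 = sin² + cos². Since 2πL cos = `kickDeriv` - 2, the quantity (L cos)² is at most the
denominator, so the cosine part costs only 1/L. -/
theorem kickKernel_le {L K : ℝ} (hK : 1 ≤ K) (hKL : K ≤ L) (t : ℝ) :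
    kickKernel L K t ≤ L * Real.sin (2 * Real.pi * t) ^ 2 / (K ^ 2 + kickDeriv L t ^ 2)
      + 1 / L := by
  have hL : 0 < L := by linarith
  have hD := kickKernel_denom_pos (by linarith : 0 < K) (kickDeriv L t)
  unfold kickKernel
  rw [← sub_le_iff_le_add', ← sub_div, div_le_div_iff₀ hD hL]
  set c := Real.cos (2 * Real.pi * t) with hc
  have hs : Real.sin (2 * Real.pi * t) ^ 2 = 1 - c ^ 2 := by
    have := Real.sin_sq_add_cos_sq (2 * Real.pi * t)
    linarith
  have hk : 2 * Real.pi * L * c = kickDeriv L t - 2 := by simp [kickDeriv, hc]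
  rw [hs]
  have h1 : (2 * Real.pi * L * c) ^ 2 ≤ 2 * kickDeriv L t ^ 2 + 8 := by
    rw [hk]
    nlinarith [sq_nonneg (kickDeriv L t + 2)]
  have h2 : 8 * (L * c) ^ 2 ≤ (2 * Real.pi * L * c) ^ 2 := by
    have : (2 * Real.pi * L * c) ^ 2 = 4 * Real.pi ^ 2 * (L * c) ^ 2 := by ring
    rw [this]
    have : 9 ≤ Real.pi ^ 2 := by nlinarith [Real.pi_gt_three]
    nlinarith [sq_nonneg (L * c)]
  nlinarith

/-- The part with sin² is a multiple of sin times the derivative of arctan(`kickDeriv`/K)/K.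
Integrating by parts leaves a bounded integrand of size 1/K, with no need to locate the zeros of
`kickDeriv`. -/
theorem integral_kickKernel_le {L K : ℝ} (hK : 1 ≤ K) (hKL : K ≤ L) :
    ∫ t in (0 : ℝ)..1, kickKernel L K t ≤ 2 / K := by
  have hL : 0 < L := by linarith
  have hK0 : 0 < K := by linarith
  have hkc := (contDiff_kickDeriv L).continuous
  set A : ℝ → ℝ := fun t => Real.arctan (kickDeriv L t / K) / K with hA
  set A' : ℝ → ℝ := fun t => -(4 * Real.pi ^ 2 * L * Real.sin (2 * Real.pi * t))
    / (K ^ 2 + kickDeriv L t ^ 2) with hA'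
  have hAd : ∀ t, HasDerivAt A (A' t) t := fun t => by
    have h := (((hasDerivAt_kickDeriv L t).div_const K).arctan).div_const K
    refine h.congr_deriv ?_
    have := kickKernel_denom_pos hK0 (kickDeriv L t)
    have : 0 < 1 + (kickDeriv L t / K) ^ 2 := by positivity
    simp only [hA']
    field_simp
  have hA'c : Continuous A' :=
    Continuous.div (by fun_prop) (by fun_prop) fun t => (kickKernel_denom_pos hK0 _).ne'
  have hAc : Continuous A := continuous_iff_continuousAt.2 fun t => (hAd t).continuousAt
  have hsd : ∀ t : ℝ, HasDerivAt (fun t => Real.sin (2 * Real.pi * t))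
      (Real.cos (2 * Real.pi * t) * (2 * Real.pi)) t := fun t => (hasDerivAt_two_pi_mul t).sin
  have hparts := intervalIntegral.integral_mul_deriv_eq_deriv_mul (a := (0 : ℝ)) (b := 1)
    (u := fun t => Real.sin (2 * Real.pi * t)) (v := A)
    (fun t _ => hsd t) (fun t _ => hAd t)
    (Continuous.intervalIntegrable (by fun_prop) _ _) (hA'c.intervalIntegrable _ _)
  have hbd : ‖∫ t in (0 : ℝ)..1, Real.cos (2 * Real.pi * t) * (2 * Real.pi) * A t‖ ≤
      Real.pi ^ 2 / K * |1 - 0| := by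
    refine intervalIntegral.norm_integral_le_of_norm_le_const fun t _ => ?_
    have h1 := Real.abs_cos_le_one (2 * Real.pi * t)
    have h2 : |A t| ≤ Real.pi / 2 / K := by
      rw [hA, abs_div, abs_of_pos hK0]
      gcongr
      exact abs_le.2 ⟨by linarith [Real.neg_pi_div_two_lt_arctan (kickDeriv L t / K)],
        (Real.arctan_lt_pi_div_two _).le⟩
    rw [Real.norm_eq_abs, abs_mul, abs_mul, abs_of_pos (by positivity : 0 < 2 * Real.pi)]
    calc _ ≤ 1 * (2 * Real.pi) * (Real.pi / 2 / K) := by gcongr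
      _ = Real.pi ^ 2 / K := by ring
  have hle : ∫ t in (0 : ℝ)..1, kickKernel L K t ≤
      ∫ t in (0 : ℝ)..1, (-(1 / (4 * Real.pi ^ 2)) * (Real.sin (2 * Real.pi * t) * A' t)
        + 1 / L) := by
    refine intervalIntegral.integral_mono_on zero_le_one
      ((continuous_kickKernel L hK0).intervalIntegrable _ _)
      (Continuous.intervalIntegrable (by fun_prop) _ _) fun t _ => ?_
    refine (kickKernel_le hK hKL t).trans (le_of_eq ?_)
    have := kickKernel_denom_pos hK0 (kickDeriv L t)
    simp only [hA']
    field_simp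
  rw [intervalIntegral.integral_add (Continuous.intervalIntegrable (by fun_prop) _ _)
    (by simp), intervalIntegral.integral_const_mul, hparts] at hle
  simp only [mul_one, mul_zero, Real.sin_two_pi, Real.sin_zero, zero_mul, sub_self, sub_zero,
    zero_sub, abs_one, intervalIntegral.integral_const, smul_eq_mul, one_mul] at hle hbd
  rw [Real.norm_eq_abs] at hbd
  have h3 := (le_abs_self _).trans hbd
  have h4 : 1 / (4 * Real.pi ^ 2) * (∫ t in (0 : ℝ)..1,
      Real.cos (2 * Real.pi * t) * (2 * Real.pi) * A t) ≤ 1 / (4 * K) := by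
    calc _ ≤ 1 / (4 * Real.pi ^ 2) * (Real.pi ^ 2 / K) := by gcongr
      _ = 1 / (4 * K) := by field_simp
  have h5 : 1 / L ≤ 1 / K := by gcongr
  have h6 : 1 / (4 * K) + 1 / K ≤ 2 / K := by
    have : 0 < 1 / K := by positivity
    have h7 : 1 / (4 * K) = 1 / K / 4 := by ring
    have h8 : 2 / K = 2 * (1 / K) := by ring
    rw [h7, h8]
    linarith
  linarith

/-! ### Equidistribution along a closed curve -/

/-- A primitive of a periodic function of mean zero is periodic, so `u` may be replaced by its
fractional part. -/
theorem abs_integral_le_of_periodic {g : ℝ → ℝ} (hg : Continuous g) (hp : Function.Periodic g 1)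
    (h0 : ∫ t in (0 : ℝ)..1, g t = 0) (u : ℝ) :
    |∫ t in (0 : ℝ)..u, g t| ≤ ∫ t in (0 : ℝ)..1, |g t| := by
  have hper : Function.Periodic (fun u => ∫ t in (0 : ℝ)..u, g t) 1 := fun v => by
    have h1 := hp.intervalIntegral_add_eq v 0
    rw [zero_add, h0] at h1
    have h2 := intervalIntegral.integral_add_adjacent_intervals
      (hg.intervalIntegrable (μ := volume) 0 v) (hg.intervalIntegrable v (v + 1))
    rw [h1, add_zero] at h2
    exact h2.symm
  have h1 : ∫ t in (0 : ℝ)..u, g t = ∫ t in (0 : ℝ)..Int.fract u, g t := by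
    have := hper.sub_int_mul_eq (x := u) ⌊u⌋
    simp only [mul_one] at this
    exact this.symm
  rw [h1]
  have hf0 := Int.fract_nonneg u
  have hf1 := (Int.fract_lt_one u).le
  refine (intervalIntegral.abs_integral_le_integral_abs hf0).trans ?_
  exact intervalIntegral.integral_mono_interval le_rfl hf0 hf1
    (Filter.Eventually.of_forall fun t => abs_nonneg (g t)) (hg.abs.intervalIntegrable _ _)

/-- Integration by parts along a curve: the weight `p * x'` is close to uniform on the circle when
`p` has small variation. -/
theorem abs_integral_weight_sub_le {x p h : ℝ → ℝ} (hx : ContDiff ℝ 1 x) (hp : ContDiff ℝ 1 p)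
    (hxm : ∃ m : ℤ, x 1 = x 0 + m) (hp1 : p 1 = p 0) (hh : Continuous h)
    (hper : Function.Periodic h 1) :
    |(∫ t in (0 : ℝ)..1, p t * deriv x t * h (x t))
        - (∫ t in (0 : ℝ)..1, h t) * ∫ t in (0 : ℝ)..1, p t * deriv x t|
      ≤ 2 * (∫ t in (0 : ℝ)..1, |h t|) * ∫ t in (0 : ℝ)..1, |deriv p t| := by
  set c := ∫ t in (0 : ℝ)..1, h t with hc
  set B := ∫ t in (0 : ℝ)..1, |h t| with hB
  have hx' := hx.continuous_deriv le_rfl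
  have hp' := hp.continuous_deriv le_rfl
  have hxc := hx.continuous
  have hpc := hp.continuous
  set H : ℝ → ℝ := fun u => ∫ t in (0 : ℝ)..u, (h t - c) with hH
  have hgc : Continuous fun t => h t - c := by fun_prop
  have hHd : ∀ u, HasDerivAt H (h u - c) u := fun u => hgc.integral_hasStrictDerivAt 0 u |>.hasDerivAt
  have hHc : Continuous H := continuous_iff_continuousAt.2 fun t => (hHd t).continuousAt
  have hgper : Function.Periodic (fun t => h t - c) 1 := fun t => by simp [hper t]
  have hg0 : ∫ t in (0 : ℝ)..1, (h t - c) = 0 := by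
    rw [intervalIntegral.integral_sub (hh.intervalIntegrable _ _) (by simp)]
    simp [hc]
  have hcB : |c| ≤ B := intervalIntegral.abs_integral_le_integral_abs zero_le_one
  have hHb : ∀ u, |H u| ≤ 2 * B := fun u => by
    refine (abs_integral_le_of_periodic hgc hgper hg0 u).trans ?_
    have : ∫ t in (0 : ℝ)..1, |h t - c| ≤ ∫ t in (0 : ℝ)..1, (|h t| + |c|) :=
      intervalIntegral.integral_mono_on zero_le_one (hgc.abs.intervalIntegrable _ _)
        (Continuous.intervalIntegrable (by fun_prop) _ _) fun t _ => abs_sub _ _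
    rw [intervalIntegral.integral_add (hh.abs.intervalIntegrable _ _) (by simp)] at this
    simp only [intervalIntegral.integral_const, sub_zero, one_smul] at this
    linarith
  have hHper : Function.Periodic H 1 := fun v => by
    have h1 := hgper.intervalIntegral_add_eq v 0
    rw [zero_add, hg0] at h1
    have h2 := intervalIntegral.integral_add_adjacent_intervals
      (hgc.intervalIntegrable (μ := volume) 0 v) (hgc.intervalIntegrable v (v + 1))
    rw [h1, add_zero] at h2
    exact h2.symm
  -- The curve closes up modulo 1, so the boundary terms of the integration by parts cancel.
  have hHx : H (x 1) = H (x 0) := by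
    obtain ⟨m, hm⟩ := hxm
    rw [hm]
    simpa using hHper.int_mul m (x 0)
  have hparts := intervalIntegral.integral_mul_deriv_eq_deriv_mul (a := (0 : ℝ)) (b := 1)
    (u := p) (v := fun t => H (x t)) (u' := deriv p) (v' := fun t => (h (x t) - c) * deriv x t)
    (fun t _ => (hp.differentiable one_ne_zero t).hasDerivAt)
    (fun t _ => (hHd (x t)).comp t (hx.differentiable one_ne_zero t).hasDerivAt)
    (hp'.intervalIntegrable _ _) (Continuous.intervalIntegrable (by fun_prop) _ _)
  rw [hHx, hp1, sub_self, zero_sub] at hparts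
  have hlhs : (∫ t in (0 : ℝ)..1, p t * deriv x t * h (x t))
      - c * ∫ t in (0 : ℝ)..1, p t * deriv x t =
      ∫ t in (0 : ℝ)..1, p t * ((h (x t) - c) * deriv x t) := by
    rw [← intervalIntegral.integral_const_mul, ← intervalIntegral.integral_sub
      (Continuous.intervalIntegrable (by fun_prop) _ _)
      (Continuous.intervalIntegrable (by fun_prop) _ _)]
    congr 1
    ext t
    ring
  rw [hlhs, hparts, abs_neg, ← intervalIntegral.integral_const_mul]
  refine (intervalIntegral.abs_integral_le_integral_abs zero_le_one).trans ?_
  refine intervalIntegral.integral_mono_on zero_le_one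
    (Continuous.intervalIntegrable (by fun_prop) _ _)
    (Continuous.intervalIntegrable (by fun_prop) _ _) fun t _ => ?_
  rw [abs_mul, mul_comm]
  gcongr
  exact hHb _

/-! ### Weighted curves and their evolution under one step -/

/-- A curve of orbits: `z` and `x` are two successive positions, `σ` is the ratio of their
derivatives, and `p` is a weight whose product with `x'` takes values in `[0, 1]`. -/
structure WeightedCurve (z x σ p : ℝ → ℝ) : Prop where
  contDiff_prev : ContDiff ℝ 1 z
  contDiff_pos : ContDiff ℝ 1 x
  contDiff_slope : ContDiff ℝ 1 σ
  contDiff_weight : ContDiff ℝ 1 p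
  closed_prev : ∃ m : ℤ, z 1 = z 0 + m
  closed_pos : ∃ m : ℤ, x 1 = x 0 + m
  closed_slope : σ 1 = σ 0
  closed_weight : p 1 = p 0
  abs_slope_le : ∀ t, |σ t| ≤ 1
  mass_nonneg : ∀ t, 0 ≤ p t * deriv x t
  mass_le_one : ∀ t, p t * deriv x t ≤ 1
  slope_mul : ∀ t, σ t * (p t * deriv x t) = p t * deriv z t

/-- The total variation of the weight, together with the weighted variation of the slope. -/
noncomputable def curveVariation (σ p : ℝ → ℝ) : ℝ :=
  ∫ t in (0 : ℝ)..1, (|deriv p t| + |p t * deriv σ t|)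

/-- The slope after one step with cutoff scale `K`. -/
noncomputable def nextSlope (L K : ℝ) (x σ : ℝ → ℝ) (t : ℝ) : ℝ :=
  cutInv ((kickDeriv L (x t) - σ t) / K) / K

/-- The weight after one step with cutoff scale `K`. -/
noncomputable def nextWeight (L K : ℝ) (x σ p : ℝ → ℝ) (t : ℝ) : ℝ :=
  p t * (cutQuot ((kickDeriv L (x t) - σ t) / K) / K)

/-- A slope of size at most 1 is negligible against K ≥ 2: the difference of the cross-multiplied
sides is K² + (u - 2s)² - 2s² ≥ 0. -/
theorem div_scaled_sq_le {K s u : ℝ} (hK : 2 ≤ K) (hs : |s| ≤ 1) :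
    1 / (K ^ 2 * (1 + ((u - s) / K) ^ 2)) ≤ 2 / (K ^ 2 + u ^ 2) := by
  have hK0 : 0 < K := by linarith
  have h1 : K ^ 2 * (1 + ((u - s) / K) ^ 2) = K ^ 2 + (u - s) ^ 2 := by
    field_simp
  rw [h1, div_le_div_iff₀ (by positivity) (by positivity)]
  have h2 : s ^ 2 ≤ 1 := (sq_le_one_iff_abs_le_one s).2 hs
  nlinarith [sq_nonneg (u - 2 * s)]

namespace WeightedCurve

variable {z x σ p : ℝ → ℝ} {L K : ℝ}

theorem continuous_mass (hc : WeightedCurve z x σ p) :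
    Continuous fun t => p t * deriv x t :=
  hc.contDiff_weight.continuous.mul (hc.contDiff_pos.continuous_deriv le_rfl)

theorem continuous_variation_integrand (hc : WeightedCurve z x σ p) :
    Continuous fun t => |deriv p t| + |p t * deriv σ t| := by
  have h1 := hc.contDiff_weight.continuous
  have h2 := hc.contDiff_weight.continuous_deriv le_rfl
  have h3 := hc.contDiff_slope.continuous_deriv le_rfl
  fun_prop

theorem curveVariation_nonneg (σ p : ℝ → ℝ) : 0 ≤ curveVariation σ p :=
  intervalIntegral.integral_nonneg zero_le_one fun t _ => by positivity

theorem integral_abs_deriv_le (hc : WeightedCurve z x σ p) :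
    ∫ t in (0 : ℝ)..1, |deriv p t| ≤ curveVariation σ p := by
  have h2 := hc.contDiff_weight.continuous_deriv le_rfl
  refine intervalIntegral.integral_mono_on zero_le_one (h2.abs.intervalIntegrable _ _)
    (hc.continuous_variation_integrand.intervalIntegrable _ _) fun t _ => ?_
  exact le_add_of_nonneg_right (abs_nonneg _)

theorem integral_mass_le_one (hc : WeightedCurve z x σ p) :
    ∫ t in (0 : ℝ)..1, p t * deriv x t ≤ 1 := by
  have h := intervalIntegral.integral_mono_on (μ := volume) zero_le_one
    (hc.continuous_mass.intervalIntegrable 0 1) (intervalIntegrable_const (c := (1 : ℝ)))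
    fun t _ => hc.mass_le_one t
  simpa using h

theorem abs_integral_mass_mul_sub_le (hc : WeightedCurve z x σ p) {h : ℝ → ℝ}
    (hh : Continuous h) (hper : Function.Periodic h 1) :
    |(∫ t in (0 : ℝ)..1, p t * deriv x t * h (x t))
        - (∫ t in (0 : ℝ)..1, h t) * ∫ t in (0 : ℝ)..1, p t * deriv x t|
      ≤ 2 * (∫ t in (0 : ℝ)..1, |h t|) * curveVariation σ p := by
  refine (abs_integral_weight_sub_le hc.contDiff_pos hc.contDiff_weight hc.closed_pos
    hc.closed_weight hh hper).trans ?_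
  have : 0 ≤ ∫ t in (0 : ℝ)..1, |h t| :=
    intervalIntegral.integral_nonneg zero_le_one fun t _ => abs_nonneg _
  gcongr
  exact hc.integral_abs_deriv_le

/-- The bootstrap: equidistribution of the current curve, tested on the kernel itself, shows that
little weighted mass lies near the critical points of the next step. The kernel is large pointwise,
but only its L¹ norm enters. -/
theorem integral_mass_mul_kickKernel_le (hc : WeightedCurve z x σ p) (hK : 1 ≤ K) (hKL : K ≤ L) :
    ∫ t in (0 : ℝ)..1, p t * deriv x t * kickKernel L K (x t)
      ≤ 2 / K * (1 + 2 * curveVariation σ p) := by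
  have hL : 0 ≤ L := by linarith
  have h1 := (le_abs_self _).trans (hc.abs_integral_mass_mul_sub_le
    (continuous_kickKernel L (by linarith : 0 < K)) (periodic_kickKernel L K))
  simp only [abs_of_nonneg (kickKernel_nonneg hL K _)] at h1
  have h2 := integral_kickKernel_le hK hKL
  have h3 : 0 ≤ ∫ t in (0 : ℝ)..1, kickKernel L K t :=
    intervalIntegral.integral_nonneg zero_le_one fun t _ => kickKernel_nonneg hL K t
  have h4 := hc.integral_mass_le_one
  have h5 := curveVariation_nonneg σ p
  calc _ ≤ (∫ t in (0 : ℝ)..1, kickKernel L K t) * (∫ t in (0 : ℝ)..1, p t * deriv x t)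
        + 2 * (∫ t in (0 : ℝ)..1, kickKernel L K t) * curveVariation σ p := by linarith
    _ ≤ (∫ t in (0 : ℝ)..1, kickKernel L K t) * 1
        + 2 * (∫ t in (0 : ℝ)..1, kickKernel L K t) * curveVariation σ p := by gcongr
    _ = (∫ t in (0 : ℝ)..1, kickKernel L K t) * (1 + 2 * curveVariation σ p) := by ring
    _ ≤ _ := by gcongr

theorem contDiff_argument (hc : WeightedCurve z x σ p) (L K : ℝ) :
    ContDiff ℝ 1 fun t => (kickDeriv L (x t) - σ t) / K :=
  (((contDiff_kickDeriv L).comp hc.contDiff_pos).sub hc.contDiff_slope).div_const K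

theorem contDiff_nextSlope (hc : WeightedCurve z x σ p) (L K : ℝ) :
    ContDiff ℝ 1 (nextSlope L K x σ) :=
  (contDiff_cutInv.comp (hc.contDiff_argument L K)).div_const K

theorem contDiff_nextWeight (hc : WeightedCurve z x σ p) (L K : ℝ) :
    ContDiff ℝ 1 (nextWeight L K x σ p) :=
  hc.contDiff_weight.mul ((contDiff_cutQuot.comp (hc.contDiff_argument L K)).div_const K)

theorem deriv_next (hc : WeightedCurve z x σ p) (L : ℝ) (t : ℝ) :
    deriv (fun t => kick L (x t) - z t) t = kickDeriv L (x t) * deriv x t - deriv z t :=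
  (((hasDerivAt_kick L (x t)).comp t (hc.contDiff_pos.differentiable one_ne_zero t).hasDerivAt).sub
    (hc.contDiff_prev.differentiable one_ne_zero t).hasDerivAt).deriv

/-- The slope relation is needed only after multiplication by the weight, so it may fail where the
weight vanishes. -/
theorem mass_next (hc : WeightedCurve z x σ p) (hK : 0 < K) (t : ℝ) :
    nextWeight L K x σ p t * deriv (fun t => kick L (x t) - z t) t =
      p t * deriv x t * (cutQuot ((kickDeriv L (x t) - σ t) / K)
        * ((kickDeriv L (x t) - σ t) / K)) := by
  rw [hc.deriv_next, nextWeight]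
  have h := hc.slope_mul t
  generalize cutQuot ((kickDeriv L (x t) - σ t) / K) = q
  field_simp
  linear_combination q * h

theorem next (hc : WeightedCurve z x σ p) (hK : 2 ≤ K) :
    WeightedCurve x (fun t => kick L (x t) - z t) (nextSlope L K x σ)
      (nextWeight L K x σ p) := by
  have hK0 : 0 < K := by linarith
  have harg : kickDeriv L (x 1) = kickDeriv L (x 0) := by
    obtain ⟨m, hm⟩ := hc.closed_pos
    rw [hm, kickDeriv_add_int]
  exact
  { contDiff_prev := hc.contDiff_pos
    contDiff_pos := ((contDiff_kick L).comp hc.contDiff_pos).sub hc.contDiff_prev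
    contDiff_slope := hc.contDiff_nextSlope L K
    contDiff_weight := hc.contDiff_nextWeight L K
    closed_prev := hc.closed_pos
    closed_pos := by
      obtain ⟨m, hm⟩ := hc.closed_pos
      obtain ⟨k, hk⟩ := hc.closed_prev
      refine ⟨2 * m - k, ?_⟩
      rw [hm, hk, kick_add_int]
      push_cast
      ring
    closed_slope := by rw [nextSlope, nextSlope, harg, hc.closed_slope]
    closed_weight := by rw [nextWeight, nextWeight, harg, hc.closed_slope, hc.closed_weight]
    abs_slope_le := fun t => by
      rw [nextSlope, abs_div, abs_of_pos hK0, div_le_one hK0]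
      exact (abs_cutInv_le _).trans hK
    mass_nonneg := fun t => by
      rw [hc.mass_next hK0]
      exact mul_nonneg (hc.mass_nonneg t) (cutQuot_mul_self_nonneg _)
    mass_le_one := fun t => by
      rw [hc.mass_next hK0]
      exact mul_le_one₀ (hc.mass_le_one t) (cutQuot_mul_self_nonneg _)
        (cutQuot_mul_self_le_one _)
    slope_mul := fun t => by
      rw [hc.mass_next hK0, nextSlope, nextWeight]
      have h := cutQuot_mul_cutInv_mul ((kickDeriv L (x t) - σ t) / K)
      generalize (kickDeriv L (x t) - σ t) / K = τ at h ⊢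
      linear_combination (p t * deriv x t / K) * h }

theorem hasDerivAt_comp_argument (hc : WeightedCurve z x σ p) (L K : ℝ) {g : ℝ → ℝ}
    (hg : ContDiff ℝ 1 g) (t : ℝ) :
    HasDerivAt (fun t => g ((kickDeriv L (x t) - σ t) / K) / K)
      (deriv g ((kickDeriv L (x t) - σ t) / K)
        * ((deriv (kickDeriv L) (x t) * deriv x t - deriv σ t) / K) / K) t := by
  have hx := (hc.contDiff_pos.differentiable one_ne_zero t).hasDerivAt
  have hσ := (hc.contDiff_slope.differentiable one_ne_zero t).hasDerivAt
  have hk := ((contDiff_kickDeriv L).differentiable one_ne_zero (x t)).hasDerivAt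
  have hg := (hg.differentiable one_ne_zero ((kickDeriv L (x t) - σ t) / K)).hasDerivAt
  exact (hg.comp t (((hk.comp t hx).sub hσ).div_const K)).div_const K

/-- The second derivative of the kick is at most 40 L and meets the mass, giving the kernel; the old
slope variation is damped by K². Stated for general `g` to serve both `cutQuot` and `cutInv`. -/
theorem abs_mul_deriv_comp_argument_le (hc : WeightedCurve z x σ p) (hL : 0 ≤ L) (hK : 2 ≤ K)
    {g : ℝ → ℝ} (hg : ∀ t, |deriv g t| ≤ 50 / (1 + t ^ 2)) (t : ℝ) :
    |p t * (deriv g ((kickDeriv L (x t) - σ t) / K)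
        * ((deriv (kickDeriv L) (x t) * deriv x t - deriv σ t) / K) / K)|
      ≤ 4000 * (p t * deriv x t * kickKernel L K (x t)) + 100 / K ^ 2 * |p t * deriv σ t| := by
  have hK0 : 0 < K := by linarith
  set τ := (kickDeriv L (x t) - σ t) / K with hτ
  have h1 : |p t * (deriv g τ * ((deriv (kickDeriv L) (x t) * deriv x t - deriv σ t) / K) / K)|
      = |deriv g τ| / K ^ 2 *
        |deriv (kickDeriv L) (x t) * (p t * deriv x t) - p t * deriv σ t| := by
    have h0 : |deriv g τ| / K ^ 2 = |deriv g τ / K ^ 2| := by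
      rw [abs_div, abs_of_pos (pow_pos hK0 2)]
    rw [h0, ← abs_mul]
    congr 1
    field_simp
  have h2 : |deriv g τ| / K ^ 2 ≤ 100 / (K ^ 2 + kickDeriv L (x t) ^ 2) := by
    have := div_scaled_sq_le (u := kickDeriv L (x t)) hK (hc.abs_slope_le t)
    calc |deriv g τ| / K ^ 2 ≤ 50 / (1 + τ ^ 2) / K ^ 2 := by gcongr; exact hg τ
      _ = 50 * (1 / (K ^ 2 * (1 + τ ^ 2))) := by field_simp
      _ ≤ 50 * (2 / (K ^ 2 + kickDeriv L (x t) ^ 2)) := by gcongr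
      _ = _ := by ring
  have h3 : |deriv (kickDeriv L) (x t) * (p t * deriv x t) - p t * deriv σ t|
      ≤ 40 * L * (p t * deriv x t) + |p t * deriv σ t| := by
    refine (abs_sub _ _).trans ?_
    rw [abs_mul, abs_of_nonneg (hc.mass_nonneg t)]
    gcongr
    · exact hc.mass_nonneg t
    · exact abs_deriv_kickDeriv_le hL _
  have h4 : 100 / (K ^ 2 + kickDeriv L (x t) ^ 2) ≤ 100 / K ^ 2 := by
    gcongr
    nlinarith [sq_nonneg (kickDeriv L (x t))]
  rw [h1]
  calc _ ≤ 100 / (K ^ 2 + kickDeriv L (x t) ^ 2) *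
        (40 * L * (p t * deriv x t) + |p t * deriv σ t|) := by gcongr
    _ = 4000 * (p t * deriv x t * kickKernel L K (x t))
        + 100 / (K ^ 2 + kickDeriv L (x t) ^ 2) * |p t * deriv σ t| := by
      unfold kickKernel; ring
    _ ≤ _ := by gcongr

/-- Old variation is damped by a factor of order 1/K, and fresh variation comes only from the kernel
term. Including the weighted slope variation in `curveVariation` is what closes the recursion. -/
theorem variation_next_le (hc : WeightedCurve z x σ p) (hK : 2 ≤ K) (hKL : K ≤ L) :
    curveVariation (nextSlope L K x σ) (nextWeight L K x σ p)
      ≤ 40000 / K * (1 + curveVariation σ p) := by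
  have hK0 : 0 < K := by linarith
  have hL : 0 ≤ L := by linarith
  have hV := curveVariation_nonneg σ p
  have hpt : ∀ t, |deriv (nextWeight L K x σ p) t|
      + |nextWeight L K x σ p t * deriv (nextSlope L K x σ) t| ≤
      8000 * (p t * deriv x t * kickKernel L K (x t))
        + 200 / K * (|deriv p t| + |p t * deriv σ t|) := fun t => by
    have hQ := hc.hasDerivAt_comp_argument L K contDiff_cutQuot t
    have hR := hc.hasDerivAt_comp_argument L K contDiff_cutInv t
    have hQb := hc.abs_mul_deriv_comp_argument_le hL hK abs_deriv_cutQuot_le t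
    have hRb := hc.abs_mul_deriv_comp_argument_le hL hK abs_deriv_cutInv_le t
    have hp := (hc.contDiff_weight.differentiable one_ne_zero t).hasDerivAt
    have h1 : deriv (nextWeight L K x σ p) t = _ := (hp.mul hQ).deriv
    have h2 : deriv (nextSlope L K x σ) t = _ := hR.deriv
    rw [h1, h2]
    have hq : |cutQuot ((kickDeriv L (x t) - σ t) / K) / K| ≤ 1 / K := by
      rw [abs_div, abs_of_pos hK0]
      gcongr
      exact abs_cutQuot_le _
    have hq1 : 1 / K ≤ 1 := by rw [div_le_one hK0]; linarith
    rw [nextWeight, mul_right_comm, abs_mul _ (cutQuot _ / K)]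
    -- In the slope term the extra factor from the new weight is at most 1/K ≤ 1 and is discarded.
    have h3 := mul_le_of_le_one_right (abs_nonneg (p t * (deriv cutInv
      ((kickDeriv L (x t) - σ t) / K) * ((deriv (kickDeriv L) (x t) * deriv x t - deriv σ t) / K)
        / K))) (hq.trans hq1)
    have h4 : |deriv p t * (cutQuot ((kickDeriv L (x t) - σ t) / K) / K)| ≤
        |deriv p t| * (1 / K) := by
      rw [abs_mul]
      gcongr
    have h5 : 100 / K ^ 2 * |p t * deriv σ t| ≤ 100 / K * |p t * deriv σ t| := by
      gcongr
      nlinarith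
    have h6 : |deriv p t| * (1 / K) ≤ 200 / K * |deriv p t| := by
      rw [mul_comm]
      gcongr
      norm_num
    have h7 : 200 / K * (|deriv p t| + |p t * deriv σ t|) =
        200 / K * |deriv p t| + 2 * (100 / K * |p t * deriv σ t|) := by ring
    have h8 := abs_add_le (deriv p t * (cutQuot ((kickDeriv L (x t) - σ t) / K) / K))
      (p t * (deriv cutQuot ((kickDeriv L (x t) - σ t) / K)
        * ((deriv (kickDeriv L) (x t) * deriv x t - deriv σ t) / K) / K))
    linarith
  have hkc : Continuous fun t => p t * deriv x t * kickKernel L K (x t) :=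
    hc.continuous_mass.mul ((continuous_kickKernel L hK0).comp hc.contDiff_pos.continuous)
  have hvc := hc.continuous_variation_integrand
  have h1 := intervalIntegral.integral_mono_on (μ := volume) zero_le_one
    ((hc.next (L := L) hK).continuous_variation_integrand.intervalIntegrable 0 1)
    (((hkc.const_mul _).add (hvc.const_mul _)).intervalIntegrable 0 1) fun t _ => hpt t
  have hadd : ∫ t in (0 : ℝ)..1, (8000 * (p t * deriv x t * kickKernel L K (x t))
      + 200 / K * (|deriv p t| + |p t * deriv σ t|)) = _ :=
    intervalIntegral.integral_add ((hkc.const_mul _).intervalIntegrable _ _)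
      ((hvc.const_mul _).intervalIntegrable _ _)
  simp only [Pi.add_apply] at h1
  rw [hadd, intervalIntegral.integral_const_mul, intervalIntegral.integral_const_mul] at h1
  have h2 := hc.integral_mass_mul_kickKernel_le (by linarith : 1 ≤ K) hKL
  calc curveVariation (nextSlope L K x σ) (nextWeight L K x σ p)
      ≤ 8000 * (2 / K * (1 + 2 * curveVariation σ p)) + 200 / K * curveVariation σ p := by
        refine h1.trans ?_
        unfold curveVariation at h2 ⊢
        gcongr
    _ = 1 / K * (16000 + 32200 * curveVariation σ p) := by ring
    _ ≤ 1 / K * (40000 + 40000 * curveVariation σ p) := by gcongr <;> norm_num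
    _ = _ := by ring

theorem integral_mass_sub_next_le (hc : WeightedCurve z x σ p) (hK : 2 ≤ K) (hKL : K ≤ L) :
    (∫ t in (0 : ℝ)..1, p t * deriv x t)
        - ∫ t in (0 : ℝ)..1, nextWeight L K x σ p t * deriv (fun t => kick L (x t) - z t) t
      ≤ 12 * K / L * (1 + 2 * curveVariation σ p) := by
  have hK0 : 0 < K := by linarith
  have hL : 0 < L := by linarith
  rw [← intervalIntegral.integral_sub (hc.continuous_mass.intervalIntegrable _ _)
    ((hc.next (L := L) hK).continuous_mass.intervalIntegrable _ _)]
  have hkc : Continuous fun t => p t * deriv x t * kickKernel L K (x t) :=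
    hc.continuous_mass.mul ((continuous_kickKernel L hK0).comp hc.contDiff_pos.continuous)
  have h1 := intervalIntegral.integral_mono_on (μ := volume) zero_le_one
    ((hc.continuous_mass.sub (hc.next (L := L) hK).continuous_mass).intervalIntegrable 0 1)
    (Continuous.intervalIntegrable (hkc.const_mul (6 * K ^ 2 / L)) 0 1) fun t _ => ?_
  · rw [intervalIntegral.integral_const_mul] at h1
    refine h1.trans ?_
    calc _ ≤ 6 * K ^ 2 / L * (2 / K * (1 + 2 * curveVariation σ p)) := by
          gcongr
          exact hc.integral_mass_mul_kickKernel_le (by linarith) hKL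
      _ = _ := by field_simp; ring
  · simp only [Pi.sub_apply]
    rw [hc.mass_next hK0, ← mul_one_sub]
    set τ := (kickDeriv L (x t) - σ t) / K with hτ
    have h2 := div_scaled_sq_le (u := kickDeriv L (x t)) hK (hc.abs_slope_le t)
    -- The discarded fraction is at most K²/L times the kernel up to a constant; the kernel integral
    -- of order 1/K then gives the loss K/L.
    have h3 : 1 - cutQuot τ * τ ≤ 6 * K ^ 2 / L * kickKernel L K (x t) := by
      calc 1 - cutQuot τ * τ ≤ 3 / (1 + τ ^ 2) := one_sub_cutQuot_mul_self_le τ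
        _ = 3 * K ^ 2 * (1 / (K ^ 2 * (1 + τ ^ 2))) := by field_simp
        _ ≤ 3 * K ^ 2 * (2 / (K ^ 2 + kickDeriv L (x t) ^ 2)) := by gcongr
        _ = _ := by unfold kickKernel; field_simp; ring
    calc _ ≤ p t * deriv x t * (6 * K ^ 2 / L * kickKernel L K (x t)) :=
          mul_le_mul_of_nonneg_left h3 (hc.mass_nonneg t)
      _ = _ := by ring

/-- The missing mass is paid for twice: in replacing 1 by p x' under the integral of h(x), and in
replacing the total mass by 1 in front of the mean of h. -/
theorem abs_integral_comp_sub_le (hc : WeightedCurve z x σ p) {h : ℝ → ℝ} (hh : Continuous h)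
    (hper : Function.Periodic h 1) {M : ℝ} (hM : ∀ t, |h t| ≤ M) :
    |(∫ t in (0 : ℝ)..1, h (x t)) - ∫ t in (0 : ℝ)..1, h t|
      ≤ 2 * M * curveVariation σ p
        + 2 * M * (1 - ∫ t in (0 : ℝ)..1, p t * deriv x t) := by
  have hxc := hc.contDiff_pos.continuous
  have hwc := hc.continuous_mass
  have hMint : ∫ t in (0 : ℝ)..1, |h t| ≤ M := by
    have := intervalIntegral.integral_mono_on (μ := volume) zero_le_one
      (hh.abs.intervalIntegrable 0 1) (intervalIntegrable_const (c := M)) fun t _ => hM t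
    simpa using this
  have hint : |∫ t in (0 : ℝ)..1, h t| ≤ M :=
    (intervalIntegral.abs_integral_le_integral_abs zero_le_one).trans hMint
  have hV := curveVariation_nonneg σ p
  have h1 := hc.abs_integral_mass_mul_sub_le hh hper
  have h2 : |(∫ t in (0 : ℝ)..1, h (x t)) - ∫ t in (0 : ℝ)..1, p t * deriv x t * h (x t)| ≤
      M * (1 - ∫ t in (0 : ℝ)..1, p t * deriv x t) := by
    rw [← intervalIntegral.integral_sub (Continuous.intervalIntegrable (by fun_prop) _ _)
      (Continuous.intervalIntegrable (by fun_prop) _ _)]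
    refine (intervalIntegral.abs_integral_le_integral_abs zero_le_one).trans ?_
    have h3 : M * (1 - ∫ t in (0 : ℝ)..1, p t * deriv x t) =
        ∫ t in (0 : ℝ)..1, M * (1 - p t * deriv x t) := by
      rw [intervalIntegral.integral_const_mul, intervalIntegral.integral_sub (by simp)
        (hwc.intervalIntegrable _ _)]
      simp
    rw [h3]
    refine intervalIntegral.integral_mono_on zero_le_one
      (Continuous.intervalIntegrable (by fun_prop) _ _)
      (Continuous.intervalIntegrable (by fun_prop) _ _) fun t _ => ?_
    rw [← one_sub_mul, abs_mul, abs_of_nonneg (sub_nonneg.2 (hc.mass_le_one t)), mul_comm]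
    exact mul_le_mul_of_nonneg_right (hM _) (sub_nonneg.2 (hc.mass_le_one t))
  have hw0 : 0 ≤ 1 - ∫ t in (0 : ℝ)..1, p t * deriv x t := sub_nonneg.2 hc.integral_mass_le_one
  have h4 : |(∫ t in (0 : ℝ)..1, h t) * (1 - ∫ t in (0 : ℝ)..1, p t * deriv x t)| ≤
      M * (1 - ∫ t in (0 : ℝ)..1, p t * deriv x t) := by
    rw [abs_mul, abs_of_nonneg hw0]
    gcongr
  have h5 : 2 * (∫ t in (0 : ℝ)..1, |h t|) * curveVariation σ p ≤
      2 * M * curveVariation σ p := by gcongr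
  rw [abs_le] at h1 h2 h4 ⊢
  constructor <;> linarith

end WeightedCurve

/-! ### Iteration and choice of scales -/

/-- The lift to the line of the first coordinate of an orbit, as a function of its second value:
the value at time `0` is `a` and the value at time `1` is `b`. -/
noncomputable def orbitLift (L a : ℝ) : ℕ → ℝ → ℝ
  | 0, _ => a
  | 1, b => b
  | k + 2, b => kick L (orbitLift L a (k + 1) b) - orbitLift L a k b

theorem weightedCurve_start (L a : ℝ) :
    WeightedCurve (orbitLift L a 0) (orbitLift L a 1) (fun _ => 0) (fun _ => 1) := by
  have h0 : orbitLift L a 0 = fun _ => a := rfl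
  have h1 : orbitLift L a 1 = fun b => b := rfl
  rw [h0, h1]
  exact
  { contDiff_prev := contDiff_const
    contDiff_pos := contDiff_id
    contDiff_slope := contDiff_const
    contDiff_weight := contDiff_const
    closed_prev := ⟨0, by simp⟩
    closed_pos := ⟨1, by simp⟩
    closed_slope := rfl
    closed_weight := rfl
    abs_slope_le := fun _ => by simp
    mass_nonneg := fun _ => by simp
    mass_le_one := fun _ => by simp
    slope_mul := fun _ => by simp }

/-- The bound 1 on the variation is self-reproducing: (40000/K)(1 + 1) ≤ 1 exactly when K ≥ 80000.
Each step then loses at most 3 · 12 K/L of mass. -/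
theorem exists_weightedCurve {L K : ℝ} (hK : 80000 ≤ K) (hKL : K ≤ L) (a : ℝ) (m : ℕ) :
    ∃ σ p : ℝ → ℝ, WeightedCurve (orbitLift L a m) (orbitLift L a (m + 1)) σ p ∧
      curveVariation σ p ≤ 1 ∧
      1 - ∫ t in (0 : ℝ)..1, p t * deriv (orbitLift L a (m + 1)) t ≤ m * (36 * K / L) := by
  have hK0 : 0 < K := by linarith
  have hL : 0 < L := by linarith
  induction m with
  | zero =>
    refine ⟨_, _, weightedCurve_start L a, by simp [curveVariation], ?_⟩
    have h1 : orbitLift L a (0 + 1) = fun b => b := rfl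
    rw [h1]
    simp
  | succ m ih =>
    obtain ⟨σ, p, hc, hV, hw⟩ := ih
    refine ⟨_, _, hc.next (L := L) (by linarith : 2 ≤ K), ?_, ?_⟩
    · refine (hc.variation_next_le (by linarith) hKL).trans ?_
      calc 40000 / K * (1 + curveVariation σ p) ≤ 40000 / K * (1 + 1) := by gcongr
        _ = 80000 / K := by ring
        _ ≤ 1 := by rwa [div_le_one hK0]
    · have h1 := hc.integral_mass_sub_next_le (by linarith : 2 ≤ K) hKL
      have h2 : 12 * K / L * (1 + 2 * curveVariation σ p) ≤ 36 * K / L := by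
        calc _ ≤ 12 * K / L * (1 + 2 * 1) := by gcongr
          _ = _ := by ring
      have h3 : ∫ t in (0 : ℝ)..1, nextWeight L K (orbitLift L a (m + 1)) σ p t *
          deriv (orbitLift L a (m + 1 + 1)) t = ∫ t in (0 : ℝ)..1, nextWeight L K
            (orbitLift L a (m + 1)) σ p t * deriv (fun t => kick L (orbitLift L a (m + 1) t)
              - orbitLift L a m t) t := rfl
      rw [h3]
      push_cast
      linarith

/-- Equidistribution of the `n`-th position, for a fixed initial position. -/
theorem abs_integral_orbitLift_sub_le {L : ℝ} (hL : 80000 ^ 4 ≤ L) (a : ℝ) (m : ℕ) {h : ℝ → ℝ}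
    (hh : Continuous h) (hper : Function.Periodic h 1) {M : ℝ} (hM : ∀ t, |h t| ≤ M) :
    |(∫ t in (0 : ℝ)..1, h (orbitLift L a (m + 1) t)) - ∫ t in (0 : ℝ)..1, h t|
      ≤ 200000 * M * (m * L ^ (-(3 / 4) : ℝ) + L ^ (-(1 / 2) : ℝ)) := by
  have hL0 : 0 < L := by linarith
  have hL1 : 1 ≤ L := by linarith
  have hM0 : 0 ≤ M := (abs_nonneg _).trans (hM 0)
  -- The position at time 1 is exactly uniform. Otherwise `m` now counts the steps before the last
  -- one, which is treated at its own scale.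
  rcases m with _ | m
  · have h1 : orbitLift L a (0 + 1) = fun b => b := rfl
    rw [h1, sub_self, abs_zero]
    positivity
  -- The earlier steps need only bounded variation, so a small scale keeps their loss K/L = L^(-3/4)
  -- low. The last step balances variation 1/K' against loss K'/L, hence K' = L^(1/2).
  set K := L ^ (1 / 4 : ℝ) with hKdef
  set K' := L ^ (1 / 2 : ℝ) with hK'def
  have hK : 80000 ≤ K := by
    have : (80000 : ℝ) = (80000 ^ 4) ^ (1 / 4 : ℝ) := by
      rw [← Real.rpow_natCast, ← Real.rpow_mul (by norm_num)]
      norm_num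
    rw [this]
    exact Real.rpow_le_rpow (by norm_num) hL (by norm_num)
  have hKK' : K ≤ K' := Real.rpow_le_rpow_of_exponent_le hL1 (by norm_num)
  have hK'L : K' ≤ L := by
    have := Real.rpow_le_rpow_of_exponent_le hL1 (by norm_num : (1 / 2 : ℝ) ≤ 1)
    rwa [Real.rpow_one] at this
  have hK'0 : 0 < K' := by linarith
  have e1 : K / L = L ^ (-(3 / 4) : ℝ) := by
    rw [hKdef, ← Real.rpow_sub_one hL0.ne']
    norm_num
  have e2 : K' / L = L ^ (-(1 / 2) : ℝ) := by
    rw [hK'def, ← Real.rpow_sub_one hL0.ne']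
    norm_num
  have e3 : 1 / K' = L ^ (-(1 / 2) : ℝ) := by
    rw [hK'def, Real.rpow_neg hL0.le, one_div]
  obtain ⟨σ, p, hc, hV, hw⟩ := exists_weightedCurve hK (hKK'.trans hK'L) a m
  have hn := hc.next (L := L) (by linarith : 2 ≤ K')
  have h1 := hn.abs_integral_comp_sub_le hh hper hM
  have h2 := hc.variation_next_le (by linarith : 2 ≤ K') hK'L
  have h3 := hc.integral_mass_sub_next_le (by linarith : 2 ≤ K') hK'L
  set A := L ^ (-(3 / 4) : ℝ) with hA
  set B := L ^ (-(1 / 2) : ℝ) with hB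
  have hA0 : 0 ≤ A := by positivity
  have hB0 : 0 ≤ B := by positivity
  have h4 : 40000 / K' * (1 + curveVariation σ p) ≤ 80000 * B := by
    calc _ ≤ 40000 / K' * (1 + 1) := by gcongr
      _ = 80000 * (1 / K') := by ring
      _ = _ := by rw [e3]
  have h5 : 12 * K' / L * (1 + 2 * curveVariation σ p) ≤ 36 * B := by
    calc _ ≤ 12 * K' / L * (1 + 2 * 1) := by gcongr
      _ = 36 * (K' / L) := by ring
      _ = _ := by rw [e2]
  have h6 : (m : ℝ) * (36 * K / L) = 36 * m * A := by rw [← e1]; ring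
  rw [h6] at hw
  have h7 := mul_le_mul_of_nonneg_left (h2.trans h4) (by positivity : 0 ≤ 2 * M)
  have h8 : 1 - ∫ t in (0 : ℝ)..1, nextWeight L K' (orbitLift L a (m + 1)) σ p t *
      deriv (fun t => kick L (orbitLift L a (m + 1) t) - orbitLift L a m t) t
      ≤ 36 * m * A + 36 * B := by linarith
  have h9 := mul_le_mul_of_nonneg_left h8 (by positivity : 0 ≤ 2 * M)
  refine h1.trans ?_
  have hm : (0 : ℝ) ≤ m := m.cast_nonneg
  calc _ ≤ 2 * M * (80000 * B) + 2 * M * (36 * m * A + 36 * B) := by linarith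
    _ = M * (72 * m * A + 160072 * B) := by ring
    _ ≤ M * (200000 * (m + 1) * A + 200000 * B) := by gcongr <;> linarith
    _ = _ := by push_cast; ring

/-! ### From the line back to the torus -/

theorem continuous_of_continuous_periodicLift {g : UnitAddCircle → ℝ}
    (hg : Continuous (periodicLift g)) : Continuous g :=
  (QuotientAddGroup.isQuotientMap_mk (N := AddSubgroup.zmultiples (1 : ℝ))).continuous_iff.2 hg

theorem periodic_periodicLift (g : UnitAddCircle → ℝ) : Function.Periodic (periodicLift g) 1 :=
  fun t => by
    unfold periodicLift
    rw [AddCircle.coe_add, AddCircle.coe_period, add_zero]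

theorem circleSin_coe (t : ℝ) : circleSin (t : UnitAddCircle) = Real.sin (2 * Real.pi * t) :=
  rfl

theorem continuous_circleSin : Continuous circleSin :=
  continuous_of_continuous_periodicLift
    (show Continuous fun t : ℝ => Real.sin (2 * Real.pi * t) by fun_prop)

theorem continuous_standardMap (L : ℝ) : Continuous (standardMap L) := by
  have h1 : Continuous fun p : UnitAddCircle × UnitAddCircle =>
      ((L * circleSin p.1 : ℝ) : UnitAddCircle) :=
    (AddCircle.continuous_mk' (1 : ℝ)).comp
      (continuous_const.mul (continuous_circleSin.comp continuous_fst))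
  unfold standardMap
  fun_prop

/-- The momentum is always the difference of two successive positions. The iteration starts from the
state at time 1, hence the index shift. -/
theorem standardMap_iterate_coe (L a b : ℝ) (m : ℕ) :
    (standardMap L)^[m] ((b : UnitAddCircle), ((b - a : ℝ) : UnitAddCircle)) =
      ((orbitLift L a (m + 1) b : UnitAddCircle),
        ((orbitLift L a (m + 1) b - orbitLift L a m b : ℝ) : UnitAddCircle)) := by
  induction m with
  | zero => rfl
  | succ m ih =>
    rw [Function.iterate_succ_apply', ih, standardMap]
    have h : orbitLift L a (m + 1 + 1) b =
        kick L (orbitLift L a (m + 1) b) - orbitLift L a m b := rfl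
    simp only [circleSin_coe]
    rw [h, kick]
    ext
    · simp only [← AddCircle.coe_add]
      congr 1
      ring
    · simp only [← AddCircle.coe_add]
      congr 1
      ring

theorem integral_circle_eq (g : UnitAddCircle → ℝ) :
    ∫ x : UnitAddCircle, g x = ∫ t in (0 : ℝ)..1, periodicLift g t := by
  have := UnitAddCircle.intervalIntegral_preimage 0 g
  rw [zero_add] at this
  exact this.symm

/-- For fixed `a` the first step sends y to b = y + a + s with `s` independent of y: a rotation, so
Haar invariance lets `b` replace y as the variable. -/
theorem integral_standardMap_iterate_fiber (L a : ℝ) (φ : UnitAddCircle → ℝ) (m : ℕ) :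
    ∫ y : UnitAddCircle, φ ((standardMap L)^[m + 1] ((a : UnitAddCircle), y)).1
      = ∫ t in (0 : ℝ)..1, periodicLift φ (orbitLift L a (m + 1) t) := by
  set s : UnitAddCircle := ((L * circleSin a : ℝ) : UnitAddCircle)
  set G : UnitAddCircle → ℝ := fun b => φ ((standardMap L)^[m] (b, b - (a : UnitAddCircle))).1
  have h1 : ∀ y : UnitAddCircle, φ ((standardMap L)^[m + 1] ((a : UnitAddCircle), y)).1
      = G (y + ((a : UnitAddCircle) + s)) := fun y => by
    rw [Function.iterate_succ_apply]
    have : standardMap L ((a : UnitAddCircle), y) =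
        (y + ((a : UnitAddCircle) + s), y + ((a : UnitAddCircle) + s) - (a : UnitAddCircle)) := by
      simp only [standardMap]
      ext
      · simp only [s]; abel
      · simp only [s]; abel
    rw [this]
  simp only [h1]
  rw [integral_add_right_eq_self G, integral_circle_eq]
  congr 1
  ext t
  simp only [periodicLift, G]
  rw [← AddCircle.coe_sub, standardMap_iterate_coe]

theorem bddAbove_range_abs_of_periodic {g : ℝ → ℝ} (hg : Continuous g)
    (hp : Function.Periodic g 1) : BddAbove (Set.range fun t => |g t|) := by
  have hp' : Function.Periodic (fun t => |g t|) 1 := fun t => by simp [hp t]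
  rw [← hp'.image_Icc one_pos 0]
  exact (isCompact_Icc.image hg.abs).bddAbove

theorem abs_periodicLift_le_c1Norm {g : UnitAddCircle → ℝ} (hg : IsC1 g) (t : ℝ) :
    |periodicLift g t| ≤ c1Norm g :=
  (le_ciSup (bddAbove_range_abs_of_periodic hg.continuous (periodic_periodicLift g)) t).trans
    (le_max_left _ _)

theorem abs_le_c1Norm {g : UnitAddCircle → ℝ} (hg : IsC1 g) (x : UnitAddCircle) :
    |g x| ≤ c1Norm g := by
  induction x using QuotientAddGroup.induction_on with
  | H t => exact abs_periodicLift_le_c1Norm hg t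

theorem abs_integral_fiber_sub_le {L : ℝ} (hL : 80000 ^ 4 ≤ L) {φ : UnitAddCircle → ℝ}
    (hφ : IsC1 φ) (m : ℕ) (x : UnitAddCircle) :
    |(∫ y : UnitAddCircle, φ ((standardMap L)^[m + 1] (x, y)).1) - ∫ y : UnitAddCircle, φ y|
      ≤ 200000 * c1Norm φ * (m * L ^ (-(3 / 4) : ℝ) + L ^ (-(1 / 2) : ℝ)) := by
  induction x using QuotientAddGroup.induction_on with
  | H a =>
    have h := integral_standardMap_iterate_fiber L a φ m
    rw [integral_circle_eq φ]
    refine (le_of_eq ?_).trans (abs_integral_orbitLift_sub_le hL a m hφ.continuous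
      (periodic_periodicLift φ) (abs_periodicLift_le_c1Norm hφ))
    rw [← h]

theorem theoremC :
    ∃ C : ℝ, 0 < C ∧ ∃ L₀ : ℝ, 0 < L₀ ∧ ∀ L : ℝ, L₀ ≤ L →
      ∀ φ ψ : UnitAddCircle → ℝ, IsC1 φ → IsC1 ψ → ∀ n : ℕ, 1 ≤ n →
        |(∫ p : UnitAddCircle × UnitAddCircle, ψ p.1 * φ ((standardMap L)^[n] p).1)
            - (∫ x : UnitAddCircle, φ x) * ∫ x : UnitAddCircle, ψ x|
          ≤ C * c1Norm φ * c1Norm ψ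
              * (((n : ℝ) - 1) * L ^ (-(3 / 4) : ℝ) + L ^ (-(1 / 2) : ℝ)) := by
  refine ⟨200000, by norm_num, 80000 ^ 4, by norm_num, fun L hL φ ψ hφ hψ n hn => ?_⟩
  obtain ⟨m, rfl⟩ : ∃ m, n = m + 1 := ⟨n - 1, by omega⟩
  have hφc := continuous_of_continuous_periodicLift hφ.continuous
  have hψc := continuous_of_continuous_periodicLift hψ.continuous
  have hF := (continuous_standardMap L).iterate (m + 1)
  have hcont : Continuous fun p : UnitAddCircle × UnitAddCircle =>
      ψ p.1 * φ ((standardMap L)^[m + 1] p).1 := by fun_prop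
  have hint : Integrable fun p : UnitAddCircle × UnitAddCircle =>
      ψ p.1 * φ ((standardMap L)^[m + 1] p).1 :=
    hcont.integrable_of_hasCompactSupport (HasCompactSupport.of_compactSpace _)
  have hint1 := hint.integral_prod_left
  -- By Fubini ψ is constant on each fiber; the uniform fiber estimate then needs only the supremum
  -- of |ψ|.
  rw [Measure.volume_eq_prod, integral_prod _ hint, ← integral_const_mul]
  simp only [integral_const_mul] at hint1 ⊢
  have hint2 : Integrable fun x : UnitAddCircle => (∫ y : UnitAddCircle, φ y) * ψ x :=
    (continuous_const.mul hψc).integrable_of_hasCompactSupport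
      (HasCompactSupport.of_compactSpace _)
  rw [← integral_const_mul, ← integral_sub hint1 hint2]
  set E := (m : ℝ) * L ^ (-(3 / 4) : ℝ) + L ^ (-(1 / 2) : ℝ) with hE
  have hbound : ∀ x : UnitAddCircle,
      ‖ψ x * (∫ y : UnitAddCircle, φ ((standardMap L)^[m + 1] (x, y)).1)
        - (∫ y : UnitAddCircle, φ y) * ψ x‖ ≤ c1Norm ψ * (200000 * c1Norm φ * E) := fun x => by
    rw [mul_comm (∫ y : UnitAddCircle, φ y), ← mul_sub, norm_mul]
    exact mul_le_mul (abs_le_c1Norm hψ x) (abs_integral_fiber_sub_le hL hφ m x)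
      (norm_nonneg _) ((abs_nonneg _).trans (abs_le_c1Norm hψ x))
  have h := norm_integral_le_of_norm_le_const (μ := (volume : Measure UnitAddCircle))
    (Filter.Eventually.of_forall hbound)
  rw [Real.norm_eq_abs] at h
  refine h.trans (le_of_eq ?_)
  simp only [measureReal_def, UnitAddCircle.measure_univ, ENNReal.toReal_one, hE]
  push_cast
  ring
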